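/- **Central Limit Theorem for the Sample Latent Correlation.** *Threshold model.* Let $Z=(Z_1,\dots,Z_d)\sim\varphi$ be a random vector in $\mathbb R^d$ whose coordinates have continuous CDFs $F_1,\dots,F_d$ with quantile functions $F_k^{-1}(p)=\inf\{x: p\le F_k(x)\}$, and let $\theta=(\theta_1,\dots,\theta_d)\sim\nu$ be a random vector in $(0,1)^d$ that is independent of $Z$. Put $$X_k=\mathbb I\big(Z_k\le F_k^{-1}(\theta_k)\big),\qquad U_k=\frac{X_k-\theta_k}{\sqrt{\theta_k(1-\theta_k)}},\qquad U_A=\frac1{|A|}\sum_{k\in A}U_k \quad (\emptyset\ne A\subseteq[d]),$$ $$\psi(j,k)=\mathbb E\left[\frac{(X_j-\theta_j)(X_k-\theta_k)}{\sqrt{\theta_j(1-\theta_j)\theta_k(1-\theta_k)}}\right],\qquad \Psi(A)=\frac1{|A|^2}\sum_{j,k\in A}\psi(j,k).$$ *Setting.* For each $n\ge1$ let $(\varphi_n,\nu_n)$ be a threshold model in dimension $d_n$; the dimension and both distributions may depend on $n$. Let $Z_1,\dots,Z_n\sim\varphi_n$ and $\theta_1,\dots,\theta_n\sim\nu_n$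 be independent random vectors, let $X_{ik}$, $U_{ik}$, $U_{iA}$ be formed as above from $(Z_i,\theta_i)$, and set $$\widehat\psi_n(j,A)=\frac1n\sum_{i=1}^nU_{ij}U_{iA},\qquad \widehat\sigma_n^2(j,A)=\frac1n\sum_{i=1}^nU_{ij}^2U_{iA}^2,\qquad \widehat\sigma_n(j,A)=\sqrt{\widehat\sigma_n^2(j,A)}.$$ *Theorem.* Fix $j$ (with $j\in[d_n]$ for all $n$), and for each $n$ let $A_n\subseteq[d_n]\setminus\{j\}$ be a nonempty index set with cardinality $m_n$. Assume that (i) for each $n$, $Z_j$ is independent of $\{Z_k:k\in A_n\}$ under $\varphi_n$; and (ii) as $n\to\infty$, $$\Psi(A_n)^{-2}\left(\frac1{m_n}\sum_{k\in A_n}\mathbb E\left[\theta_j^{-1}\theta_k^{-1}(1-\theta_j)^{-1}(1-\theta_k)^{-1}\right]\right)=o(n),$$ where $\Psi(A_n)$ and the expectations are taken under $(\varphi_n,\nu_n)$, and the left side is read as $+\infty$ if $\Psi(A_n)=0$ or if one of the expectations is infinite. Then $$\sqrt n\,\frac{\widehat\psi_n(j,A_n)}{\widehat\sigma_n(j,A_n)}\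 \xrightarrow{\ d\ }\ \mathcal N(0,1)\qquad\text{as } n\to\infty .$$ -/

import Mathlib

open MeasureTheory ProbabilityTheory Filter Topology
open scoped ENNReal

noncomputable section

/-- The quantile function `F⁻¹(p) = inf {x : p ≤ F x}` of a probability measure on the real line
with CDF `F`. For `p ∈ (0,1)` the set is nonempty and bounded below. -/
def quantile (μ : Measure ℝ) (p : ℝ) : ℝ := sInf {x : ℝ | p ≤ cdf μ x}

/-- A threshold model in dimension `d`: a law `φ` of the latent vector `Z`, all of whose
coordinates have continuous CDFs, and a law `ν` of the threshold vector `θ ∈ (0,1)^d`.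
The pair `(Z, θ)` has law `φ ⊗ ν`. -/
structure ThresholdModel (d : ℕ) where
  /-- the law of `Z` -/
  φ : Measure (Fin d → ℝ)
  /-- the law of `θ` -/
  ν : Measure (Fin d → ℝ)
  isProbabilityMeasure_φ : IsProbabilityMeasure φ
  isProbabilityMeasure_ν : IsProbabilityMeasure ν
  continuous_cdf : ∀ j, Continuous (cdf (φ.map (fun z => z j)))
  threshold_mem : ∀ᵐ t ∂ν, ∀ j, t j ∈ Set.Ioo (0 : ℝ) 1

namespace ThresholdModel

attribute [instance] isProbabilityMeasure_φ isProbabilityMeasure_ν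

variable {d : ℕ} (M : ThresholdModel d)

open scoped Classical in
/-- The observed binary variable `X_j = 𝟙(Z_j ≤ F_j⁻¹(θ_j))`, where `Z = z` and `θ = t`. -/
def X (z t : Fin d → ℝ) (j : Fin d) : ℝ :=
  if z j ≤ quantile (M.φ.map (fun w => w j)) (t j) then 1 else 0

/-- `U_j = (X_j - θ_j) / √(θ_j (1 - θ_j))`. -/
def U (z t : Fin d → ℝ) (j : Fin d) : ℝ :=
  (M.X z t j - t j) / √(t j * (1 - t j))

/-- `U_A`, the average of `U_k` over `k ∈ A`. -/
def UAvg (z t : Fin d → ℝ) (A : Finset (Fin d)) : ℝ :=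
  (1 / (A.card : ℝ)) * ∑ k ∈ A, M.U z t k

/-- The latent correlation
`ψ(j,k) = E[(X_j - θ_j)(X_k - θ_k) / √(θ_j (1 - θ_j) θ_k (1 - θ_k))]`. -/
def psi (j k : Fin d) : ℝ :=
  ∫ p : (Fin d → ℝ) × (Fin d → ℝ),
    ((M.X p.1 p.2 j - p.2 j) * (M.X p.1 p.2 k - p.2 k)) /
      √(p.2 j * (1 - p.2 j) * (p.2 k * (1 - p.2 k))) ∂(M.φ.prod M.ν)

/-- `Ψ(A)`, the average pairwise latent correlation between the variables in `A`. -/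
def Psi (A : Finset (Fin d)) : ℝ :=
  (1 / (A.card : ℝ) ^ 2) * ∑ j ∈ A, ∑ k ∈ A, M.psi j k

/-- The sample latent correlation `ψ̂_n(j,A) = n⁻¹ ∑_i U_{ij} U_{iA}` of the sample
`(z_i, t_i)`, `i = 1, …, n`. -/
def psiHat {n : ℕ} (z t : Fin n → Fin d → ℝ) (j : Fin d) (A : Finset (Fin d)) : ℝ :=
  (1 / (n : ℝ)) * ∑ i, M.U (z i) (t i) j * M.UAvg (z i) (t i) A

/-- The variance estimate `σ̂²_n(j,A) = n⁻¹ ∑_i U_{ij}² U_{iA}²`. -/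
def sigmaHatSq {n : ℕ} (z t : Fin n → Fin d → ℝ) (j : Fin d) (A : Finset (Fin d)) : ℝ :=
  (1 / (n : ℝ)) * ∑ i, (M.U (z i) (t i) j) ^ 2 * (M.UAvg (z i) (t i) A) ^ 2

/-- `σ̂_n(j,A)`. -/
def sigmaHat {n : ℕ} (z t : Fin n → Fin d → ℝ) (j : Fin d) (A : Finset (Fin d)) : ℝ :=
  √(M.sigmaHatSq z t j A)

/-- `E[θ_j⁻¹ θ_k⁻¹ (1 - θ_j)⁻¹ (1 - θ_k)⁻¹] ∈ [0, ∞]`; the integrand is positive. -/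
def thresholdMoment (j k : Fin d) : ℝ≥0∞ :=
  ∫⁻ t, ENNReal.ofReal ((t j)⁻¹ * (t k)⁻¹ * (1 - t j)⁻¹ * (1 - t k)⁻¹) ∂M.ν

/-- `Ψ(A)⁻² · (1/|A|) ∑_{k ∈ A} E[θ_j⁻¹ θ_k⁻¹ (1 - θ_j)⁻¹ (1 - θ_k)⁻¹]` for nonempty `A`, as an
element of `[0, ∞]`. It is finite only if `Ψ(A) ≠ 0` and all the expectations are finite
(every expectation is positive, so that `Ψ(A) = 0` gives the value `∞`). -/
def momentRatio (j : Fin d) (A : Finset (Fin d)) : ℝ≥0∞ :=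
  (ENNReal.ofReal (M.Psi A) ^ 2)⁻¹ * ((A.card : ℝ≥0∞)⁻¹ * ∑ k ∈ A, M.thresholdMoment j k)

end ThresholdModel

end

/-! Fix the thresholds. Each `X_k` is then Bernoulli(`θ_k`), so `U_k` has conditional mean 0 and
variance 1, and by (i) `U_j` and `U_A` are conditionally independent, being functions of `Z_j` and
of `(Z_k)_{k ∈ A}`. Averaging over `θ`, whose coordinates may be dependent, gives `E[U_j U_A] = 0`
and `E[(U_j U_A)²] = E[U_A²] = Ψ(A)`. Since `E[U_k⁴ | θ] ≤ 1/(θ_k(1-θ_k))` and `U_A⁴` is at most the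
average of the `U_k⁴`, the fourth moment of `U_j U_A / √Ψ(A)` is at most `momentRatio`.

Assumption (ii) is therefore Lyapunov's condition of order four for the standardized products, which
are i.i.d. within each row. It gives a central limit theorem for their sum and, by Chebyshev,
convergence to 1 of the mean of their squares. The statistic does not change when the products are
rescaled, so it is the normalized sum divided by the root of that mean, and Slutsky's theorem
concludes. -/

/-! ### Characteristic functions under a fourth-moment bound. -/

/-- Third-order Taylor bound for the complex exponential on the imaginary axis. -/
lemma norm_exp_mul_I_sub_taylor_le (x : ℝ) :
    ‖Complex.exp (x * Complex.I) - (1 + x * Complex.I - x ^ 2 / 2)‖ ≤ 4 * |x| ^ 3 := by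
  -- For `|x| ≤ 1` the remainder is at most `|x|³ e` and `e ≤ 4`; for `|x| > 1` the triangle
  -- inequality gives `2 + |x| + |x|²/2 ≤ 4|x|³`.
  rcases le_or_gt |x| 1 with h | h
  · have := Complex.norm_exp_sub_sum_le_norm_mul_exp (x * Complex.I) 3
    have e : ∑ m ∈ Finset.range 3, (x * Complex.I) ^ m / (m.factorial : ℂ)
        = 1 + x * Complex.I - x ^ 2 / 2 := by
      simp [Finset.sum_range_succ, mul_pow, Nat.factorial]
      ring
    have hn : ‖(x * Complex.I : ℂ)‖ = |x| := by simp
    rw [e, hn] at this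
    refine this.trans ?_
    rw [mul_comm]
    gcongr
    calc Real.exp |x| ≤ Real.exp 1 := Real.exp_le_exp.2 h
      _ ≤ 4 := by linarith [Real.exp_one_lt_d9]
  · have h1 : ‖Complex.exp (x * Complex.I)‖ = 1 := Complex.norm_exp_ofReal_mul_I x
    have h2 : ‖(1 + x * Complex.I - x ^ 2 / 2 : ℂ)‖ ≤ 1 + |x| + |x| ^ 2 / 2 := by
      refine (norm_sub_le _ _).trans (add_le_add ((norm_add_le _ _).trans ?_) ?_) <;> simp
    refine (norm_sub_le _ _).trans ?_
    rw [h1]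
    nlinarith [mul_pos (sub_pos.2 h) (sub_pos.2 h), pow_pos (sub_pos.2 h) 3]

section Moments

variable {μ : Measure ℝ} [IsProbabilityMeasure μ]

/-- Third-order expansion of the characteristic function of a standardized law in terms of its
fourth moment. -/
lemma norm_charFun_sub_le (h4 : Integrable (fun x : ℝ => x ^ 4) μ) (h1 : ∫ x, x ∂μ = 0)
    (h2 : ∫ x, x ^ 2 ∂μ = 1) (s : ℝ) :
    ‖charFun μ s - (1 - s ^ 2 / 2)‖ ≤ 4 * |s| ^ 3 * √(∫ x, x ^ 4 ∂μ) := by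
  -- A non-integrable function has integral 0 by convention, which contradicts `h2`.
  have i2 : Integrable (fun x : ℝ => x ^ 2) μ := by
    by_contra h
    simp [integral_undef h] at h2
  have i1 : Integrable (fun x : ℝ => x) μ := by
    refine (i2.add (integrable_const 1)).mono (by fun_prop) (ae_of_all _ fun x => ?_)
    simp only [Real.norm_eq_abs, Pi.add_apply]
    rw [abs_of_nonneg (by positivity : 0 ≤ x ^ 2 + 1)]
    nlinarith [sq_abs x, sq_nonneg (|x| - 1), abs_nonneg x]
  set L := ∫ x, x ^ 4 ∂μ with hL
  have hL1 : 0 < L := by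
    have : 0 ≤ ∫ x, (x ^ 2 - 1) ^ 2 ∂μ := integral_nonneg fun x => sq_nonneg _
    have e : ∫ x, (x ^ 2 - 1) ^ 2 ∂μ = L - 2 * 1 + 1 := by
      have : ∀ x : ℝ, (x ^ 2 - 1) ^ 2 = x ^ 4 - 2 * x ^ 2 + 1 := fun x => by ring
      simp_rw [this]
      have i42 : Integrable (fun x : ℝ => x ^ 4 - 2 * x ^ 2) μ := h4.sub (i2.const_mul 2)
      rw [integral_add i42 (integrable_const _), integral_sub h4 (i2.const_mul 2), integral_const_mul, h2]
      simp [hL]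
    linarith
  have hr : 0 < √L := Real.sqrt_pos.2 hL1
  -- AM-GM on `|x|³ = |x| · |x|²`, weighted by `√L` so that both resulting terms integrate to `√L`.
  have dom : ∀ x : ℝ, ‖Complex.exp (((s * x : ℝ) : ℂ) * Complex.I)
      - (1 + ((s * x : ℝ) : ℂ) * Complex.I - ((s * x : ℝ) : ℂ) ^ 2 / 2)‖
      ≤ 4 * |s| ^ 3 * ((√L * x ^ 2 + x ^ 4 / √L) / 2) := by
    intro x
    refine (norm_exp_mul_I_sub_taylor_le (s * x)).trans ?_
    rw [abs_mul, mul_pow, ← mul_assoc]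
    gcongr
    have : |x| ^ 3 ≤ (√L * |x| ^ 2 + |x| ^ 4 / √L) / 2 := by
      have e : (√L * |x| ^ 2 + |x| ^ 4 / √L) / 2 - |x| ^ 3
          = |x| ^ 2 * (√L - |x|) ^ 2 / (2 * √L) := by
        field_simp
        ring
      have : 0 ≤ |x| ^ 2 * (√L - |x|) ^ 2 / (2 * √L) := by positivity
      linarith
    rwa [sq_abs, (by decide : Even 4).pow_abs] at this
  have ie : Integrable (fun x : ℝ => Complex.exp (((s * x : ℝ) : ℂ) * Complex.I)) μ := by
    refine (integrable_const (1 : ℝ)).mono' (by fun_prop) (ae_of_all _ fun x => ?_)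
    rw [Complex.norm_exp_ofReal_mul_I]
  have j1 : Integrable (fun x : ℝ => ((s * x : ℝ) : ℂ) * Complex.I) μ :=
    ((i1.const_mul s).ofReal).mul_const _
  have j2 : Integrable (fun x : ℝ => ((s * x : ℝ) : ℂ) ^ 2 / 2) μ := by
    have : Integrable (fun x : ℝ => (((s ^ 2 / 2) * x ^ 2 : ℝ) : ℂ)) μ :=
      (i2.const_mul (s ^ 2 / 2)).ofReal
    refine this.congr (ae_of_all _ fun x => ?_)
    push_cast
    ring
  have j01 : Integrable (fun x : ℝ => (1 : ℂ) + ((s * x : ℝ) : ℂ) * Complex.I) μ :=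
    (integrable_const _).add j1
  have key : charFun μ s - (1 - s ^ 2 / 2) = ∫ x, (Complex.exp (((s * x : ℝ) : ℂ) * Complex.I)
      - (1 + ((s * x : ℝ) : ℂ) * Complex.I - ((s * x : ℝ) : ℂ) ^ 2 / 2)) ∂μ := by
    have j012 : Integrable (fun x : ℝ => (1 : ℂ) + ((s * x : ℝ) : ℂ) * Complex.I
        - ((s * x : ℝ) : ℂ) ^ 2 / 2) μ := j01.sub j2
    rw [integral_sub ie j012, integral_sub j01 j2, integral_add (integrable_const _) j1,
      charFun_apply_real, integral_mul_const, integral_complex_ofReal, integral_const_mul, h1]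
    have : ∫ x : ℝ, ((s * x : ℝ) : ℂ) ^ 2 / 2 ∂μ = (s : ℂ) ^ 2 / 2 := by
      have : ∀ x : ℝ, ((s * x : ℝ) : ℂ) ^ 2 / 2 = (((s ^ 2 / 2) * x ^ 2 : ℝ) : ℂ) := fun x => by
        push_cast
        ring
      simp_rw [this]
      rw [integral_complex_ofReal, integral_const_mul, h2]
      push_cast
      ring
    rw [this]
    simp
  rw [key]
  refine (norm_integral_le_of_norm_le (((i2.const_mul (√L)).add (h4.div_const (√L))).div_const 2
    |>.const_mul (4 * |s| ^ 3)) (ae_of_all _ dom)).trans (le_of_eq ?_)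
  rw [integral_const_mul]
  congr 1
  rw [integral_div]
  simp only [Pi.add_apply]
  rw [integral_add (i2.const_mul _) (h4.div_const _), integral_const_mul, integral_div, h2, ← hL]
  field_simp
  rw [Real.sq_sqrt hL1.le]
  ring

end Moments

/-- Lyapunov's condition of order four gives convergence of the characteristic functions of the
normalized row sums of a triangular array with i.i.d. rows. -/
lemma tendsto_charFun_pow_of_fourth_moment {μ : ℕ → Measure ℝ} [∀ n, IsProbabilityMeasure (μ n)]
    (h4 : ∀ᶠ n in atTop, Integrable (fun x : ℝ => x ^ 4) (μ n))
    (h1 : ∀ᶠ n in atTop, ∫ x, x ∂(μ n) = 0) (h2 : ∀ᶠ n in atTop, ∫ x, x ^ 2 ∂(μ n) = 1)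
    (hL : Tendsto (fun n : ℕ => (∫ x, x ^ 4 ∂(μ n)) / n) atTop (𝓝 0)) (t : ℝ) :
    Tendsto (fun n : ℕ => charFun (μ n) ((√n)⁻¹ * t) ^ n) atTop
      (𝓝 (Complex.exp (-(t ^ 2 / 2 : ℂ)))) := by
  -- It suffices that `n(charFun - 1)` converges, because `(1 + a_n/n)^n → exp(lim a_n)`. The error
  -- is of order `n · n^(-3/2) · √L = √(L/n)`.
  have : Tendsto (fun n : ℕ => (n : ℂ) * (charFun (μ n) ((√n)⁻¹ * t) - 1)) atTop
      (𝓝 (-(t ^ 2 / 2 : ℂ))) := by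
    rw [tendsto_iff_norm_sub_tendsto_zero]
    have lim : Tendsto (fun n : ℕ => 4 * |t| ^ 3 * √((∫ x, x ^ 4 ∂(μ n)) / n)) atTop (𝓝 0) := by
      have := (hL.sqrt).const_mul (4 * |t| ^ 3)
      simpa using this
    refine squeeze_zero' (Eventually.of_forall fun n => norm_nonneg _) ?_ lim
    filter_upwards [h4, h1, h2, eventually_gt_atTop 0] with n a b c hn
    have hn' : (0 : ℝ) < n := by exact_mod_cast hn
    have hs : 0 < √(n : ℝ) := Real.sqrt_pos.2 hn'
    have hss : √(n : ℝ) ^ 2 = n := Real.sq_sqrt hn'.le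
    have e : (n : ℂ) * (charFun (μ n) ((√n)⁻¹ * t) - 1) - -(t ^ 2 / 2 : ℂ)
        = n * (charFun (μ n) ((√n)⁻¹ * t) - (1 - (((√n)⁻¹ * t : ℝ) : ℂ) ^ 2 / 2)) := by
      have : (n : ℂ) * (((√n)⁻¹ * t : ℝ) : ℂ) ^ 2 = t ^ 2 := by
        rw [← Complex.ofReal_natCast, ← Complex.ofReal_pow, ← Complex.ofReal_mul, mul_pow, inv_pow,
          hss, mul_inv_cancel_left₀ hn'.ne', Complex.ofReal_pow]
      linear_combination (-1 / 2 : ℂ) * this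
    rw [e, norm_mul, Complex.norm_natCast]
    calc (n : ℝ) * _ ≤ n * (4 * |(√n)⁻¹ * t| ^ 3 * √(∫ x, x ^ 4 ∂(μ n))) := by
          gcongr
          exact norm_charFun_sub_le a b c _
      _ = 4 * |t| ^ 3 * √((∫ x, x ^ 4 ∂(μ n)) / n) := by
          rw [Real.sqrt_div' _ hn'.le, abs_mul, abs_inv, abs_of_pos hs]
          nth_rewrite 1 [← hss]
          field_simp
  simpa using Complex.tendsto_one_add_pow_exp_of_tendsto this

/-! ### Slutsky's theorem on varying probability spaces. -/

section Slutsky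

variable {Ω : ℕ → Type*} [∀ n, MeasurableSpace (Ω n)] {P : ∀ n, Measure (Ω n)}
  [∀ n, IsProbabilityMeasure (P n)]

/-- Slutsky's theorem for products of real random variables on varying probability spaces: if
`X n` converges in distribution to `T` and `Y n` converges in probability to `1`, then `X n * Y n`
converges in distribution to `T`. -/
lemma tendstoInDistribution_mul_of_tendsto_one {Ω' : Type*} [MeasurableSpace Ω'] {P' : Measure Ω'}
    [IsProbabilityMeasure P'] {X Y : ∀ n, Ω n → ℝ} {T : Ω' → ℝ}
    (hX : TendstoInDistribution X atTop T P P') (hYm : ∀ n, AEMeasurable (Y n) (P n))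
    (hY : ∀ ε > 0, Tendsto (fun n => P n {ω | ε ≤ |Y n ω - 1|}) atTop (𝓝 0)) :
    TendstoInDistribution (fun n ω => X n ω * Y n ω) atTop T P P' := by
  -- All the spaces are placed on one infinite product. `X n` and `Y n` read the same coordinate, so
  -- their joint law is kept and the single-space theorem applies.
  have mp := fun n => measurePreserving_eval_infinitePi P n
  have mapEq : ∀ (V : ∀ n, Ω n → ℝ) (n : ℕ), AEMeasurable (V n) (P n) →
      (Measure.infinitePi P).map (fun ω => V n (ω n)) = (P n).map (V n) := by
    intro V n hV
    have := AEMeasurable.map_map_of_aemeasurable (μ := Measure.infinitePi P)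
      (f := Function.eval n) (g := V n) (by rwa [(mp n).map_eq]) (mp n).measurable.aemeasurable
    rw [(mp n).map_eq] at this
    exact this.symm
  have aem : ∀ (V : ∀ n, Ω n → ℝ) (n : ℕ), AEMeasurable (V n) (P n) →
      AEMeasurable (fun ω : ∀ n, Ω n => V n (ω n)) (Measure.infinitePi P) :=
    fun V n hV => hV.comp_quasiMeasurePreserving (mp n).quasiMeasurePreserving
  have hXm := hX.forall_aemeasurable
  have hX' : TendstoInDistribution (fun n (ω : ∀ n, Ω n) => X n (ω n)) atTop T
      (fun _ => Measure.infinitePi P) P' := by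
    refine ⟨fun n => aem X n (hXm n), hX.aemeasurable_limit, ?_⟩
    refine hX.tendsto.congr fun n => Subtype.ext ?_
    exact (mapEq X n (hXm n)).symm
  have hY' : TendstoInMeasure (Measure.infinitePi P) (fun n (ω : ∀ n, Ω n) => Y n (ω n)) atTop
      (fun _ => (1 : ℝ)) := by
    rw [tendstoInMeasure_iff_norm]
    intro ε hε
    refine (hY ε hε).congr fun n => ?_
    have hms : NullMeasurableSet {ω | ε ≤ |Y n ω - 1|} (P n) :=
      nullMeasurableSet_le aemeasurable_const (((hYm n).sub_const 1).abs)
    exact ((mp n).measure_preimage hms).symm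
  have key := hX'.continuous_comp_prodMk_of_tendstoInMeasure_const
    (g := fun p : ℝ × ℝ => p.1 * p.2) (by fun_prop) hY' (fun n => aem Y n (hYm n))
  refine ⟨fun n => (hXm n).mul (hYm n), hX.aemeasurable_limit, ?_⟩
  have lim := key.tendsto
  simp only [mul_one] at lim
  refine lim.congr fun n => Subtype.ext ?_
  exact mapEq (fun n ω => X n ω * Y n ω) n ((hXm n).mul (hYm n))

end Slutsky

/-! ### Limit theorems for triangular arrays. -/

section TriangularArray

variable {Ω : ℕ → Type*} [∀ n, MeasurableSpace (Ω n)] {P : ∀ n, Measure (Ω n)}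
  [∀ n, IsProbabilityMeasure (P n)] {μ : ℕ → Measure ℝ}
  {Y : ∀ n, Fin n → Ω n → ℝ}

/-- Lyapunov's central limit theorem (of order four) for triangular arrays with i.i.d. rows. -/
theorem tendstoInDistribution_row_sum [∀ n, IsProbabilityMeasure (μ n)]
    (hlaw : ∀ n i, HasLaw (Y n i) (μ n) (P n))
    (hindep : ∀ n, iIndepFun (Y n) (P n))
    (h4 : ∀ᶠ n in atTop, Integrable (fun x : ℝ => x ^ 4) (μ n))
    (h1 : ∀ᶠ n in atTop, ∫ x, x ∂(μ n) = 0) (h2 : ∀ᶠ n in atTop, ∫ x, x ^ 2 ∂(μ n) = 1)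
    (hL : Tendsto (fun n : ℕ => (∫ x, x ^ 4 ∂(μ n)) / n) atTop (𝓝 0)) :
    TendstoInDistribution (fun (n : ℕ) ω => (√(n : ℝ))⁻¹ * ∑ i, Y n i ω) atTop (id : ℝ → ℝ) P
      (gaussianReal 0 1) := by
  have hm : ∀ n i, AEMeasurable (Y n i) (P n) := fun n i => (hlaw n i).aemeasurable
  have hs : ∀ n, AEMeasurable (fun ω => ∑ i, Y n i ω) (P n) := fun n =>
    Finset.aemeasurable_fun_sum _ fun i _ => hm n i
  refine ⟨fun n => (hs n).const_mul _, aemeasurable_id, ?_⟩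
  refine ProbabilityMeasure.tendsto_iff_tendsto_charFun.2 fun t => ?_
  have lim := tendsto_charFun_pow_of_fourth_moment h4 h1 h2 hL t
  have e : charFun ((gaussianReal 0 1).map (id : ℝ → ℝ)) t
      = Complex.exp (-(t ^ 2 / 2 : ℂ)) := by
    rw [Measure.map_id, charFun_gaussianReal]
    simp
  simp only [ProbabilityMeasure.coe_mk]
  rw [e]
  refine lim.congr fun n => ?_
  rw [charFun_map_mul_comp (hs n), (hindep n).charFun_map_fun_sum_eq_prod (hm n)]
  simp [fun i => (hlaw n i).map_eq]

/-- Weak law of large numbers for the squares of a triangular array with i.i.d. rows. -/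
lemma tendsto_measure_mean_sq_sub_one (hlaw : ∀ n i, HasLaw (Y n i) (μ n) (P n))
    (hindep : ∀ n, iIndepFun (Y n) (P n))
    (h4 : ∀ᶠ n in atTop, Integrable (fun x : ℝ => x ^ 4) (μ n))
    (h2 : ∀ᶠ n in atTop, ∫ x, x ^ 2 ∂(μ n) = 1)
    (hL : Tendsto (fun n : ℕ => (∫ x, x ^ 4 ∂(μ n)) / n) atTop (𝓝 0)) {ε : ℝ} (hε : 0 < ε) :
    Tendsto (fun n : ℕ => P n {ω | ε ≤ |1 / (n : ℝ) * ∑ i, Y n i ω ^ 2 - 1|}) atTop (𝓝 0) := by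
  have lim : Tendsto (fun n : ℕ => ENNReal.ofReal ((∫ x, x ^ 4 ∂(μ n)) / n / ε ^ 2)) atTop
      (𝓝 0) := by
    have := ENNReal.tendsto_ofReal (hL.div_const (ε ^ 2))
    simpa using this
  refine tendsto_of_tendsto_of_tendsto_of_le_of_le' tendsto_const_nhds lim
    (Eventually.of_forall fun n => zero_le) ?_
  filter_upwards [h4, h2, eventually_gt_atTop 0] with n a c hn
  have hn' : (0 : ℝ) < n := by exact_mod_cast hn
  have hm : ∀ i, AEMeasurable (Y n i) (P n) := fun i => (hlaw n i).aemeasurable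
  have hL2μ : MemLp (fun x : ℝ => x ^ 2) 2 (μ n) := by
    rw [memLp_two_iff_integrable_sq (by fun_prop)]
    refine a.congr (ae_of_all _ fun x => ?_)
    ring
  have hL2 : ∀ i, MemLp (fun ω => Y n i ω ^ 2) 2 (P n) := by
    intro i
    rw [← (hlaw n i).map_eq] at hL2μ
    exact hL2μ.comp_of_map (hm i)
  have hmean : ∀ i, ∫ ω, Y n i ω ^ 2 ∂(P n) = 1 := by
    intro i
    rw [← c]
    exact (hlaw n i).integral_comp (f := fun x : ℝ => x ^ 2) (by fun_prop)
  have h4i : ∀ i, ∫ ω, (Y n i ω ^ 2) ^ 2 ∂(P n) = ∫ x, x ^ 4 ∂(μ n) := by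
    intro i
    have := (hlaw n i).integral_comp (f := fun x : ℝ => x ^ 4) (by fun_prop)
    rw [← this]
    refine integral_congr_ae (ae_of_all _ fun ω => ?_)
    simp only [Function.comp]
    ring
  set S : Ω n → ℝ := ∑ i, fun ω => Y n i ω ^ 2 with hS
  have hSL : MemLp S 2 (P n) := memLp_finsetSum' _ fun i _ => hL2 i
  have hSmean : ∫ ω, S ω ∂(P n) = n := by
    simp only [hS, Finset.sum_apply]
    rw [integral_finsetSum _ fun i _ => (hL2 i).integrable one_le_two]
    simp [hmean]
  -- The variance of a square is at most the fourth moment, so Chebyshev bounds the probability by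
  -- `L / (n ε²)`.
  have hvar : variance S (P n) ≤ n * ∫ x, x ^ 4 ∂(μ n) := by
    rw [hS, IndepFun.variance_sum (fun i _ => hL2 i)]
    · refine (Finset.sum_le_card_nsmul _ _ (∫ x, x ^ 4 ∂(μ n)) fun i _ => ?_).trans ?_
      · refine (variance_le_expectation_sq (hL2 i).1).trans (le_of_eq ?_)
        exact h4i i
      · simp
    · intro i _ k _ hik
      exact ((hindep n).indepFun hik).comp (φ := fun x : ℝ => x ^ 2) (ψ := fun x : ℝ => x ^ 2)
        (by fun_prop) (by fun_prop)
  have hset : {ω | ε ≤ |1 / (n : ℝ) * ∑ i, Y n i ω ^ 2 - 1|}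
      = {ω | n * ε ≤ |S ω - ∫ ω, S ω ∂(P n)|} := by
    ext ω
    have : |S ω - n| = n * |1 / (n : ℝ) * ∑ i, Y n i ω ^ 2 - 1| := by
      rw [← abs_of_pos hn', ← abs_mul, abs_of_pos hn']
      congr 1
      simp only [hS, Finset.sum_apply]
      field_simp
    simp only [Set.mem_ofPred_eq, hSmean, this]
    rw [mul_le_mul_iff_right₀ hn']
  rw [hset]
  refine (meas_ge_le_variance_div_sq hSL (by positivity)).trans (ENNReal.ofReal_le_ofReal ?_)
  rw [div_div, div_le_div_iff₀ (by positivity) (by positivity)]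
  calc variance S (P n) * (n * ε ^ 2) ≤ (n * ∫ x, x ^ 4 ∂(μ n)) * (n * ε ^ 2) := by gcongr
    _ = _ := by ring

/-- Self-normalized central limit theorem for triangular arrays with i.i.d. standardized rows. -/
theorem tendstoInDistribution_self_normalized [∀ n, IsProbabilityMeasure (μ n)]
    (hlaw : ∀ n i, HasLaw (Y n i) (μ n) (P n))
    (hindep : ∀ n, iIndepFun (Y n) (P n))
    (h4 : ∀ᶠ n in atTop, Integrable (fun x : ℝ => x ^ 4) (μ n))
    (h1 : ∀ᶠ n in atTop, ∫ x, x ∂(μ n) = 0) (h2 : ∀ᶠ n in atTop, ∫ x, x ^ 2 ∂(μ n) = 1)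
    (hL : Tendsto (fun n : ℕ => (∫ x, x ^ 4 ∂(μ n)) / n) atTop (𝓝 0)) :
    TendstoInDistribution
      (fun (n : ℕ) ω => (√(n : ℝ))⁻¹ * (∑ i, Y n i ω) * (√(1 / (n : ℝ) * ∑ i, Y n i ω ^ 2))⁻¹)
      atTop (id : ℝ → ℝ) P (gaussianReal 0 1) := by
  have hm : ∀ n i, AEMeasurable (Y n i) (P n) := fun n i => (hlaw n i).aemeasurable
  refine tendstoInDistribution_mul_of_tendsto_one
    (tendstoInDistribution_row_sum hlaw hindep h4 h1 h2 hL) (fun n => ?_) fun ε hε => ?_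
  · exact (((Finset.aemeasurable_fun_sum _ fun i _ =>
      (hm n i).pow_const 2).const_mul (1 / (n : ℝ))).sqrt).inv
  · have hc : ContinuousAt (fun y : ℝ => (√y)⁻¹) 1 :=
      (Real.continuous_sqrt.continuousAt).inv₀ (by simp)
    obtain ⟨δ, hδ, h⟩ := Metric.continuousAt_iff.1 hc ε hε
    refine tendsto_of_tendsto_of_tendsto_of_le_of_le tendsto_const_nhds
      (tendsto_measure_mean_sq_sub_one hlaw hindep h4 h2 hL hδ) (fun n => zero_le)
      fun n => measure_mono fun ω hω => ?_
    by_contra hlt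
    have := h (x := 1 / (n : ℝ) * ∑ i, Y n i ω ^ 2) (by simpa [Real.dist_eq] using hlt)
    rw [Real.dist_eq, Real.sqrt_one, inv_one] at this
    exact absurd hω (not_le.2 this)

end TriangularArray

/-! ### Quantile functions. -/

section Quantile

variable (μ : Measure ℝ)

lemma bddBelow_le_cdf {p : ℝ} (hp : 0 < p) : BddBelow {x : ℝ | p ≤ cdf μ x} := by
  obtain ⟨b, hb⟩ := ((tendsto_cdf_atBot μ).eventually_lt_const hp).exists
  refine ⟨b, fun x hx => ?_⟩
  by_contra h
  exact absurd (hx.trans (monotone_cdf μ (not_le.1 h).le)) (not_le.2 hb)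

lemma nonempty_le_cdf {p : ℝ} (hp : p < 1) : {x : ℝ | p ≤ cdf μ x}.Nonempty := by
  obtain ⟨b, hb⟩ := ((tendsto_cdf_atTop μ).eventually_const_lt hp).exists
  exact ⟨b, hb.le⟩

lemma monotoneOn_quantile : MonotoneOn (quantile μ) (Set.Ioo 0 1) := fun _ hp _ hq hpq =>
  csInf_le_csInf (bddBelow_le_cdf μ hp.1) (nonempty_le_cdf μ hq.2) fun _ hx => hpq.trans hx

lemma measurable_quantile : Measurable (quantile μ) := by
  refine measurable_of_restrict_of_restrict_compl (measurableSet_Ioo (a := (0 : ℝ)) (b := 1)) ?_ ?_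
  · have : Monotone ((Set.Ioo (0 : ℝ) 1).domRestrict (quantile μ)) := fun x y hxy =>
      monotoneOn_quantile μ x.2 y.2 hxy
    exact this.measurable
  -- Outside `(0,1)` the defining set is all of `ℝ` (`p ≤ 0`) or empty (`p > 1`), and `sInf`
  -- defaults to 0 in both cases; only `p = 1` is exceptional.
  · have h : (Set.Ioo (0 : ℝ) 1)ᶜ.domRestrict (quantile μ)
        = fun p : ((Set.Ioo (0 : ℝ) 1)ᶜ : Set ℝ) => if (p : ℝ) = 1 then quantile μ 1 else 0 := by
      funext ⟨p, hp⟩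
      by_cases h1 : p = 1
      · simp [h1]
      · simp only [Set.domRestrict_apply, h1, if_false]
        rcases le_or_gt p 0 with h0 | h0
        · have : {x : ℝ | p ≤ cdf μ x} = Set.univ :=
            Set.eq_univ_of_forall fun x => h0.trans (cdf_nonneg μ x)
          rw [quantile, this, Real.sInf_univ]
        · have h1' : 1 < p := lt_of_le_of_ne
            (not_lt.1 fun h => hp ⟨h0, h⟩) (Ne.symm h1)
          have : {x : ℝ | p ≤ cdf μ x} = ∅ :=
            Set.eq_empty_of_forall_notMem fun x hx =>
              absurd (le_trans hx (cdf_le_one μ x)) (not_le.2 h1')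
          rw [quantile, this, Real.sInf_empty]
    rw [h]
    exact Measurable.ite (measurable_subtype_coe (measurableSet_singleton (1 : ℝ)))
      measurable_const measurable_const

variable {μ}

/-- Continuity enters twice: the superlevel set is closed, so its infimum belongs to it, and the
intermediate value theorem yields a point where the CDF equals `p`. -/
lemma cdf_quantile (hc : Continuous (cdf μ)) {p : ℝ} (hp : p ∈ Set.Ioo (0 : ℝ) 1) :
    cdf μ (quantile μ p) = p := by
  have hcl : IsClosed {x : ℝ | p ≤ cdf μ x} := isClosed_le continuous_const hc
  refine le_antisymm ?_ (hcl.csInf_mem (nonempty_le_cdf μ hp.2) (bddBelow_le_cdf μ hp.1))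
  obtain ⟨a, ha⟩ := ((tendsto_cdf_atBot μ).eventually_lt_const hp.1).exists
  obtain ⟨b, hb⟩ := ((tendsto_cdf_atTop μ).eventually_const_lt hp.2).exists
  obtain ⟨x, hx⟩ := mem_range_of_exists_le_of_exists_ge hc ⟨a, ha.le⟩ ⟨b, hb.le⟩
  calc cdf μ (quantile μ p) ≤ cdf μ x :=
        monotone_cdf μ (csInf_le (bddBelow_le_cdf μ hp.1) (by simp [hx]))
    _ = p := hx

end Quantile

/-! ### Moments conditional on the thresholds. -/

namespace ThresholdModel

variable {d : ℕ} (M : ThresholdModel d)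

lemma X_eq_zero_or_one (z t : Fin d → ℝ) (k : Fin d) : M.X z t k = 0 ∨ M.X z t k = 1 := by
  unfold X
  split_ifs <;> simp

lemma measurable_X (k : Fin d) :
    Measurable fun p : (Fin d → ℝ) × (Fin d → ℝ) => M.X p.1 p.2 k := by
  unfold X
  refine Measurable.ite (measurableSet_le (by fun_prop) ?_) measurable_const measurable_const
  exact (measurable_quantile _).comp (by fun_prop)

lemma measurable_U (k : Fin d) :
    Measurable fun p : (Fin d → ℝ) × (Fin d → ℝ) => M.U p.1 p.2 k := by
  have := M.measurable_X k
  unfold U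
  fun_prop

lemma measurable_UAvg (A : Finset (Fin d)) :
    Measurable fun p : (Fin d → ℝ) × (Fin d → ℝ) => M.UAvg p.1 p.2 A := by
  have := M.measurable_U
  unfold UAvg
  fun_prop

lemma measurable_U_mul_UAvg (j : Fin d) (A : Finset (Fin d)) :
    Measurable fun p : (Fin d → ℝ) × (Fin d → ℝ) => M.U p.1 p.2 j * M.UAvg p.1 p.2 A :=
  (M.measurable_U j).mul (M.measurable_UAvg A)

lemma measurable_U_left (t : Fin d → ℝ) (k : Fin d) : Measurable fun z => M.U z t k := by
  have h : Measurable fun z : Fin d → ℝ => (z, t) := by fun_prop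
  exact (M.measurable_U k).comp h

lemma measurable_UAvg_left (t : Fin d → ℝ) (A : Finset (Fin d)) :
    Measurable fun z => M.UAvg z t A := by
  unfold UAvg
  exact (Finset.measurable_sum _ fun k _ => M.measurable_U_left t k).const_mul _

section FixedThreshold

variable {t : Fin d → ℝ}

lemma measureReal_le_quantile {k : Fin d} (ht : t k ∈ Set.Ioo (0 : ℝ) 1) :
    M.φ.real {z | z k ≤ quantile (M.φ.map fun w => w k) (t k)} = t k := by
  have : IsProbabilityMeasure (M.φ.map fun w => w k) :=
    Measure.isProbabilityMeasure_map (measurable_pi_apply k).aemeasurable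
  have h := cdf_quantile (M.continuous_cdf k) ht
  rw [cdf_eq_real, map_measureReal_apply (by fun_prop) measurableSet_Iic] at h
  exact h

/-- Conditionally on the threshold, `X_k` is Bernoulli(`t k`); all moments of `U_k` are read off
from this. -/
lemma integral_comp_X {k : Fin d} (ht : t k ∈ Set.Ioo (0 : ℝ) 1) (g : ℝ → ℝ) :
    ∫ z, g (M.X z t k) ∂M.φ = t k * g 1 + (1 - t k) * g 0 := by
  set S : Set (Fin d → ℝ) := {z | z k ≤ quantile (M.φ.map fun w => w k) (t k)} with hS
  have hSm : MeasurableSet S := measurableSet_le (by fun_prop) measurable_const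
  have e : ∀ z, g (M.X z t k) = g 0 + S.indicator (fun _ => g 1 - g 0) z := by
    intro z
    by_cases hz : z ∈ S
    · have : z k ≤ quantile (M.φ.map fun w => w k) (t k) := hz
      simp [X, hz, this]
    · have : ¬ z k ≤ quantile (M.φ.map fun w => w k) (t k) := hz
      simp [X, hz, this]
  simp_rw [e]
  rw [integral_add (integrable_const _) ((integrable_const _).indicator hSm),
    integral_indicator_const _ hSm, M.measureReal_le_quantile ht]
  simp
  ring

lemma integral_U {k : Fin d} (ht : t k ∈ Set.Ioo (0 : ℝ) 1) : ∫ z, M.U z t k ∂M.φ = 0 := by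
  unfold U
  rw [M.integral_comp_X ht fun x => (x - t k) / √(t k * (1 - t k))]
  ring

lemma integral_U_sq {k : Fin d} (ht : t k ∈ Set.Ioo (0 : ℝ) 1) :
    ∫ z, M.U z t k ^ 2 ∂M.φ = 1 := by
  unfold U
  rw [M.integral_comp_X ht fun x => ((x - t k) / √(t k * (1 - t k))) ^ 2]
  have h0 := ht.1
  have h1 : 0 < 1 - t k := sub_pos.2 ht.2
  simp only [div_pow]
  rw [Real.sq_sqrt (by positivity)]
  field_simp
  ring

lemma integral_U_pow_four_le {k : Fin d} (ht : t k ∈ Set.Ioo (0 : ℝ) 1) :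
    ∫ z, M.U z t k ^ 4 ∂M.φ ≤ (t k)⁻¹ * (1 - t k)⁻¹ := by
  unfold U
  rw [M.integral_comp_X ht fun x => ((x - t k) / √(t k * (1 - t k))) ^ 4]
  have h0 := ht.1
  have h1 : 0 < 1 - t k := sub_pos.2 ht.2
  have hs : √(t k * (1 - t k)) ^ 4 = (t k * (1 - t k)) ^ 2 := by
    rw [show 4 = 2 * 2 from rfl, pow_mul, Real.sq_sqrt (by positivity)]
  simp only [div_pow]
  rw [hs]
  -- The leftover factor `(1-t)³ + t³ = 1 - 3t(1-t)` is at most 1.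
  have e : t k * ((1 - t k) ^ 4 / (t k * (1 - t k)) ^ 2)
      + (1 - t k) * ((0 - t k) ^ 4 / (t k * (1 - t k)) ^ 2)
      = ((1 - t k) ^ 3 + t k ^ 3) * ((t k)⁻¹ * (1 - t k)⁻¹) := by
    field_simp
    ring
  rw [e]
  refine mul_le_of_le_one_left (by positivity) ?_
  nlinarith [mul_pos h0 h1]

/-- Makes integrability automatic at a fixed threshold. The bound is not uniform in `t`, so fourth
moments over `θ` still need an assumption. -/
lemma exists_abs_U_le (t : Fin d → ℝ) (k : Fin d) : ∃ C, ∀ z, |M.U z t k| ≤ C := by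
  refine ⟨max |(0 - t k) / √(t k * (1 - t k))| |(1 - t k) / √(t k * (1 - t k))|, fun z => ?_⟩
  unfold U
  rcases M.X_eq_zero_or_one z t k with h | h <;> simp [h]

lemma exists_abs_UAvg_le (t : Fin d → ℝ) (A : Finset (Fin d)) : ∃ C, ∀ z, |M.UAvg z t A| ≤ C := by
  choose C hC using M.exists_abs_U_le t
  refine ⟨|1 / (A.card : ℝ)| * ∑ k ∈ A, C k, fun z => ?_⟩
  unfold UAvg
  rw [abs_mul]
  gcongr
  exact (Finset.abs_sum_le_sum_abs _ _).trans (Finset.sum_le_sum fun k _ => hC k z)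

lemma integrable_U_pow (t : Fin d → ℝ) (k : Fin d) (r : ℕ) :
    Integrable (fun z => M.U z t k ^ r) M.φ := by
  obtain ⟨C, hC⟩ := M.exists_abs_U_le t k
  refine Integrable.of_bound ((M.measurable_U_left t k).pow_const r).aestronglyMeasurable (C ^ r)
    (ae_of_all _ fun z => ?_)
  rw [norm_pow]
  exact pow_le_pow_left₀ (norm_nonneg _) (hC z) r

lemma integrable_UAvg_pow (t : Fin d → ℝ) (A : Finset (Fin d)) (r : ℕ) :
    Integrable (fun z => M.UAvg z t A ^ r) M.φ := by
  obtain ⟨C, hC⟩ := M.exists_abs_UAvg_le t A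
  refine Integrable.of_bound ((M.measurable_UAvg_left t A).pow_const r).aestronglyMeasurable (C ^ r)
    (ae_of_all _ fun z => ?_)
  rw [norm_pow]
  exact pow_le_pow_left₀ (norm_nonneg _) (hC z) r

/-- Convexity of `x⁴`; no assumption on the dependence among the `U_k` is needed. -/
lemma UAvg_pow_four_le (z t : Fin d → ℝ) {A : Finset (Fin d)} (hA : A.Nonempty) :
    M.UAvg z t A ^ 4 ≤ (1 / (A.card : ℝ)) * ∑ k ∈ A, M.U z t k ^ 4 := by
  have hc : (A.card : ℝ) ≠ 0 := by simpa using hA.ne_empty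
  have := Real.pow_arith_mean_le_arith_mean_pow_of_even A (fun _ => 1 / (A.card : ℝ))
    (fun k => M.U z t k) (fun _ _ => by positivity) (by simp [hc]) (n := 4) (by decide)
  simpa only [UAvg, Finset.mul_sum] using this

lemma integral_UAvg_pow_four_le (ht : ∀ k, t k ∈ Set.Ioo (0 : ℝ) 1) {A : Finset (Fin d)}
    (hA : A.Nonempty) :
    ∫ z, M.UAvg z t A ^ 4 ∂M.φ ≤ (1 / (A.card : ℝ)) * ∑ k ∈ A, (t k)⁻¹ * (1 - t k)⁻¹ := by
  calc ∫ z, M.UAvg z t A ^ 4 ∂M.φ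
      ≤ ∫ z, (1 / (A.card : ℝ)) * ∑ k ∈ A, M.U z t k ^ 4 ∂M.φ :=
        integral_mono (M.integrable_UAvg_pow t A 4)
          ((integrable_finsetSum _ fun k _ => M.integrable_U_pow t k 4).const_mul _)
          fun z => M.UAvg_pow_four_le z t hA
    _ = (1 / (A.card : ℝ)) * ∑ k ∈ A, ∫ z, M.U z t k ^ 4 ∂M.φ := by
        rw [integral_const_mul, integral_finsetSum _ fun k _ => M.integrable_U_pow t k 4]
    _ ≤ _ := by
        gcongr with k _
        exact M.integral_U_pow_four_le (ht k)

variable {j : Fin d} {A : Finset (Fin d)}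

lemma indepFun_U_UAvg
    (h : IndepFun (fun z : Fin d → ℝ => z j) (fun (z : Fin d → ℝ) (k : A) => z k) M.φ)
    (t : Fin d → ℝ) : IndepFun (fun z => M.U z t j) (fun z => M.UAvg z t A) M.φ := by
  classical
  let u : Fin d → ℝ → ℝ := fun k x =>
    ((if x ≤ quantile (M.φ.map fun w => w k) (t k) then 1 else 0) - t k) / √(t k * (1 - t k))
  have hu : ∀ k, Measurable (u k) := fun k =>
    ((Measurable.ite measurableSet_Iic measurable_const measurable_const).sub_const _).div_const _
  have hv : Measurable fun y : A → ℝ => (1 / (A.card : ℝ)) * ∑ k : A, u k (y k) := by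
    have hk : ∀ k : A, Measurable fun y : A → ℝ => u k (y k) := fun k =>
      (hu k).comp (measurable_pi_apply k)
    exact (Finset.measurable_sum _ fun k _ => hk k).const_mul _
  have := h.comp (hu j) hv
  convert this using 1
  · funext z
    simp only [U, X, u, Function.comp]
  · funext z
    simp only [UAvg, U, X, u, Function.comp]
    rw [← Finset.sum_coe_sort A]

lemma integral_U_mul_UAvg_pow
    (h : IndepFun (fun z : Fin d → ℝ => z j) (fun (z : Fin d → ℝ) (k : A) => z k) M.φ)
    (t : Fin d → ℝ) (r : ℕ) :
    ∫ z, (M.U z t j * M.UAvg z t A) ^ r ∂M.φ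
      = (∫ z, M.U z t j ^ r ∂M.φ) * ∫ z, M.UAvg z t A ^ r ∂M.φ := by
  simp_rw [mul_pow]
  exact ((M.indepFun_U_UAvg h t).comp (φ := fun x : ℝ => x ^ r) (ψ := fun x : ℝ => x ^ r)
    (by fun_prop) (by fun_prop)).integral_fun_mul_eq_mul_integral
    (M.integrable_U_pow t j r).1 (M.integrable_UAvg_pow t A r).1

lemma integrable_U_mul_UAvg_pow (t : Fin d → ℝ) (j : Fin d) (A : Finset (Fin d)) (r : ℕ) :
    Integrable (fun z => (M.U z t j * M.UAvg z t A) ^ r) M.φ := by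
  obtain ⟨C, hC⟩ := M.exists_abs_U_le t j
  simp_rw [mul_pow]
  refine (M.integrable_UAvg_pow t A r).bdd_mul (c := C ^ r)
    ((M.measurable_U_left t j).pow_const r).aestronglyMeasurable (ae_of_all _ fun z => ?_)
  rw [norm_pow]
  exact pow_le_pow_left₀ (norm_nonneg _) (hC z) r

end FixedThreshold

/-! ### Moments after averaging over the thresholds. -/

section Moments

/-- The conditional second moment is 1 for almost every threshold, so no moment assumption is
needed. -/
lemma memLp_U (k : Fin d) :
    MemLp (fun p : (Fin d → ℝ) × (Fin d → ℝ) => M.U p.1 p.2 k) 2 (M.φ.prod M.ν) := by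
  have hm := M.measurable_U k
  rw [memLp_two_iff_integrable_sq hm.aestronglyMeasurable]
  refine ⟨(hm.pow_const 2).aestronglyMeasurable, ?_⟩
  rw [hasFiniteIntegral_iff_ofReal (ae_of_all _ fun p => sq_nonneg _),
    lintegral_prod_symm _ (hm.pow_const 2).ennreal_ofReal.aemeasurable]
  calc ∫⁻ t, ∫⁻ z, ENNReal.ofReal (M.U z t k ^ 2) ∂M.φ ∂M.ν
      = ∫⁻ _, 1 ∂M.ν := by
        refine lintegral_congr_ae ?_
        filter_upwards [M.threshold_mem] with t ht
        rw [← ofReal_integral_eq_lintegral_ofReal (M.integrable_U_pow t k 2)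
          (ae_of_all _ fun z => sq_nonneg _), M.integral_U_sq (ht k), ENNReal.ofReal_one]
    _ < ∞ := by simp

lemma memLp_UAvg (A : Finset (Fin d)) :
    MemLp (fun p : (Fin d → ℝ) × (Fin d → ℝ) => M.UAvg p.1 p.2 A) 2 (M.φ.prod M.ν) := by
  unfold UAvg
  exact (memLp_finsetSum _ fun k _ => M.memLp_U k).const_mul _

lemma psi_eq_integral (j k : Fin d) :
    M.psi j k = ∫ p : (Fin d → ℝ) × (Fin d → ℝ), M.U p.1 p.2 j * M.U p.1 p.2 k
      ∂(M.φ.prod M.ν) := by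
  unfold psi
  refine integral_congr_ae ?_
  have h : ∀ᵐ p ∂(M.φ.prod M.ν), ∀ j, p.2 j ∈ Set.Ioo (0 : ℝ) 1 :=
    Measure.quasiMeasurePreserving_snd.ae M.threshold_mem
  filter_upwards [h] with p hp
  have h1 : 0 < 1 - p.2 j := sub_pos.2 (hp j).2
  have h0 := (hp j).1
  simp only [U]
  rw [Real.sqrt_mul (by positivity), div_mul_div_comm]

/-- `Ψ(A) = E[U_A²]`. -/
lemma Psi_eq_integral (A : Finset (Fin d)) :
    M.Psi A = ∫ p : (Fin d → ℝ) × (Fin d → ℝ), M.UAvg p.1 p.2 A ^ 2 ∂(M.φ.prod M.ν) := by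
  have hint : ∀ k l, Integrable (fun p : (Fin d → ℝ) × (Fin d → ℝ) =>
      M.U p.1 p.2 k * M.U p.1 p.2 l) (M.φ.prod M.ν) := fun k l =>
    (M.memLp_U k).integrable_mul (M.memLp_U l)
  have e : ∀ p : (Fin d → ℝ) × (Fin d → ℝ), M.UAvg p.1 p.2 A ^ 2
      = (1 / (A.card : ℝ) ^ 2) * ∑ k ∈ A, ∑ l ∈ A, M.U p.1 p.2 k * M.U p.1 p.2 l := by
    intro p
    rw [UAvg, mul_pow, sq (∑ k ∈ A, _), Finset.sum_mul_sum, div_pow, one_pow]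
  simp_rw [e]
  rw [integral_const_mul, integral_finsetSum _ fun k _ => integrable_finsetSum _ fun l _ =>
    hint k l]
  unfold Psi
  congr 1
  refine Finset.sum_congr rfl fun k _ => ?_
  rw [integral_finsetSum _ fun l _ => hint k l]
  exact Finset.sum_congr rfl fun l _ => M.psi_eq_integral k l

variable {j : Fin d} {A : Finset (Fin d)}

/-- Tonelli with `θ` outermost, then conditional independence splits the fourth moment. Working in
`[0, ∞]` avoids assuming finiteness, which is deduced from this bound. -/
lemma lintegral_U_mul_UAvg_pow_four_le (hA : A.Nonempty)
    (h : IndepFun (fun z : Fin d → ℝ => z j) (fun (z : Fin d → ℝ) (k : A) => z k) M.φ) :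
    ∫⁻ p : (Fin d → ℝ) × (Fin d → ℝ),
        ENNReal.ofReal ((M.U p.1 p.2 j * M.UAvg p.1 p.2 A) ^ 4) ∂(M.φ.prod M.ν)
      ≤ (A.card : ℝ≥0∞)⁻¹ * ∑ k ∈ A, M.thresholdMoment j k := by
  have hc : 0 < (A.card : ℝ) := by exact_mod_cast hA.card_pos
  have hmk : ∀ k : Fin d, Measurable fun t : Fin d → ℝ =>
      ENNReal.ofReal ((t j)⁻¹ * (t k)⁻¹ * (1 - t j)⁻¹ * (1 - t k)⁻¹) := fun k => by fun_prop
  rw [lintegral_prod_symm _ ((M.measurable_U_mul_UAvg j A).pow_const 4).ennreal_ofReal.aemeasurable]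
  calc ∫⁻ t, ∫⁻ z, ENNReal.ofReal ((M.U z t j * M.UAvg z t A) ^ 4) ∂M.φ ∂M.ν
      ≤ ∫⁻ t, (A.card : ℝ≥0∞)⁻¹ * ∑ k ∈ A,
          ENNReal.ofReal ((t j)⁻¹ * (t k)⁻¹ * (1 - t j)⁻¹ * (1 - t k)⁻¹) ∂M.ν := by
        refine lintegral_mono_ae ?_
        filter_upwards [M.threshold_mem] with t ht
        have hpos : ∀ k, 0 < t k ∧ 0 < 1 - t k := fun k => ⟨(ht k).1, sub_pos.2 (ht k).2⟩
        rw [← ofReal_integral_eq_lintegral_ofReal (M.integrable_U_mul_UAvg_pow t j A 4)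
          (ae_of_all _ fun z => (by decide : Even 4).pow_nonneg _),
          M.integral_U_mul_UAvg_pow h, ← ENNReal.ofReal_sum_of_nonneg fun k _ =>
            (mul_pos (mul_pos (mul_pos (inv_pos.2 (hpos j).1) (inv_pos.2 (hpos k).1))
              (inv_pos.2 (hpos j).2)) (inv_pos.2 (hpos k).2)).le]
        rw [← ENNReal.ofReal_natCast, ← ENNReal.ofReal_inv_of_pos hc,
          ← ENNReal.ofReal_mul (by positivity)]
        refine ENNReal.ofReal_le_ofReal ?_
        calc _ ≤ ((t j)⁻¹ * (1 - t j)⁻¹)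
              * ((1 / (A.card : ℝ)) * ∑ k ∈ A, (t k)⁻¹ * (1 - t k)⁻¹) := by
              refine mul_le_mul (M.integral_U_pow_four_le (ht j))
                (M.integral_UAvg_pow_four_le ht hA)
                (integral_nonneg fun z => (by decide : Even 4).pow_nonneg _) ?_
              exact mul_nonneg (inv_nonneg.2 (hpos j).1.le) (inv_nonneg.2 (hpos j).2.le)
          _ = _ := by
              rw [one_div, mul_left_comm, Finset.mul_sum]
              congr 1
              exact Finset.sum_congr rfl fun k _ => by ring
    _ = _ := by
        rw [lintegral_const_mul _ (Finset.measurable_sum _ fun k _ => hmk k),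
          lintegral_finsetSum _ fun k _ => hmk k]
        rfl

/-- If the threshold moments are finite, `U_j U_A` has a finite fourth moment. -/
lemma integrable_U_mul_UAvg_pow_four (hA : A.Nonempty)
    (h : IndepFun (fun z : Fin d → ℝ => z j) (fun (z : Fin d → ℝ) (k : A) => z k) M.φ)
    (hfin : (A.card : ℝ≥0∞)⁻¹ * ∑ k ∈ A, M.thresholdMoment j k ≠ ∞) :
    Integrable (fun p : (Fin d → ℝ) × (Fin d → ℝ) => (M.U p.1 p.2 j * M.UAvg p.1 p.2 A) ^ 4)
      (M.φ.prod M.ν) := by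
  refine ⟨((M.measurable_U_mul_UAvg j A).pow_const 4).aestronglyMeasurable, ?_⟩
  rw [hasFiniteIntegral_iff_ofReal (ae_of_all _ fun p => (by decide : Even 4).pow_nonneg _)]
  exact (M.lintegral_U_mul_UAvg_pow_four_le hA h).trans_lt hfin.lt_top

lemma memLp_U_mul_UAvg (hA : A.Nonempty)
    (h : IndepFun (fun z : Fin d → ℝ => z j) (fun (z : Fin d → ℝ) (k : A) => z k) M.φ)
    (hfin : (A.card : ℝ≥0∞)⁻¹ * ∑ k ∈ A, M.thresholdMoment j k ≠ ∞) :
    MemLp (fun p : (Fin d → ℝ) × (Fin d → ℝ) => M.U p.1 p.2 j * M.UAvg p.1 p.2 A) 2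
      (M.φ.prod M.ν) := by
  have hm := M.measurable_U_mul_UAvg j A
  rw [memLp_two_iff_integrable_sq hm.aestronglyMeasurable]
  refine ((M.integrable_U_mul_UAvg_pow_four hA h hfin).add (integrable_const 1)).mono'
    (hm.pow_const 2).aestronglyMeasurable (ae_of_all _ fun p => ?_)
  simp only [Pi.add_apply]
  rw [Real.norm_of_nonneg (sq_nonneg _)]
  nlinarith [sq_nonneg ((M.U p.1 p.2 j * M.UAvg p.1 p.2 A) ^ 2 - 1)]

lemma integral_U_mul_UAvg (hA : A.Nonempty)
    (h : IndepFun (fun z : Fin d → ℝ => z j) (fun (z : Fin d → ℝ) (k : A) => z k) M.φ)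
    (hfin : (A.card : ℝ≥0∞)⁻¹ * ∑ k ∈ A, M.thresholdMoment j k ≠ ∞) :
    ∫ p : (Fin d → ℝ) × (Fin d → ℝ), M.U p.1 p.2 j * M.UAvg p.1 p.2 A ∂(M.φ.prod M.ν) = 0 := by
  rw [integral_prod_symm _ ((M.memLp_U_mul_UAvg hA h hfin).integrable one_le_two)]
  refine integral_eq_zero_of_ae ?_
  filter_upwards [M.threshold_mem] with t ht
  have := M.integral_U_mul_UAvg_pow h t 1
  simp only [pow_one] at this
  simp only [this, M.integral_U (ht j), zero_mul, Pi.zero_apply]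

lemma integral_U_mul_UAvg_sq (hA : A.Nonempty)
    (h : IndepFun (fun z : Fin d → ℝ => z j) (fun (z : Fin d → ℝ) (k : A) => z k) M.φ)
    (hfin : (A.card : ℝ≥0∞)⁻¹ * ∑ k ∈ A, M.thresholdMoment j k ≠ ∞) :
    ∫ p : (Fin d → ℝ) × (Fin d → ℝ), (M.U p.1 p.2 j * M.UAvg p.1 p.2 A) ^ 2 ∂(M.φ.prod M.ν)
      = M.Psi A := by
  rw [M.Psi_eq_integral, integral_prod_symm _ (M.memLp_U_mul_UAvg hA h hfin).integrable_sq,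
    integral_prod_symm _ (M.memLp_UAvg A).integrable_sq]
  refine integral_congr_ae ?_
  filter_upwards [M.threshold_mem] with t ht
  simp only [M.integral_U_mul_UAvg_pow h, M.integral_U_sq (ht j), one_mul]

end Moments

end ThresholdModel

/-! ### From the sample to i.i.d. pairs. -/

/-- If two families are jointly independent, the family of pairs is independent. -/
lemma iIndepFun_pair_of_sumElim {Ω ι E : Type*} [Fintype ι] [MeasurableSpace Ω]
    [MeasurableSpace E] {P : Measure Ω} [IsProbabilityMeasure P] {φ ν : Measure E}
    [IsProbabilityMeasure φ] [IsProbabilityMeasure ν] {Z θ : ι → Ω → E}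
    (hZ : ∀ i, HasLaw (Z i) φ P) (hθ : ∀ i, HasLaw (θ i) ν P)
    (h : iIndepFun (Sum.elim Z θ) P) :
    (∀ i, HasLaw (fun ω => (Z i ω, θ i ω)) (φ.prod ν) P) ∧
      iIndepFun (fun i ω => (Z i ω, θ i ω)) P := by
  have hpair : ∀ i, HasLaw (fun ω => (Z i ω, θ i ω)) (φ.prod ν) P := fun i => by
    have hi : IndepFun (Z i) (θ i) P :=
      h.indepFun (i := Sum.inl i) (j := Sum.inr i) (by simp)
    exact hi.hasLaw_prod (hZ i) (hθ i)
  refine ⟨hpair, (iIndepFun_iff_hasLaw_pi_pi hpair).2 ?_⟩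
  have hs : ∀ s : ι ⊕ ι, HasLaw (Sum.elim Z θ s) (Sum.elim (fun _ => φ) (fun _ => ν) s) P := by
    rintro (i | i)
    · exact hZ i
    · exact hθ i
  have : ∀ s : ι ⊕ ι, IsProbabilityMeasure (Sum.elim (fun _ : ι => φ) (fun _ : ι => ν) s) := by
    rintro (i | i) <;> simpa
  -- Independence is read as a product joint law; regrouping the coordinates of `ι ⊕ ι` into pairs
  -- preserves the measure.
  have hall := h.hasLaw_pi hs
  have m1 := measurePreserving_sumPiEquivProdPi
    (X := fun _ : ι ⊕ ι => E) (Sum.elim (fun _ : ι => φ) (fun _ : ι => ν))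
  have m2 := (measurePreserving_arrowProdEquivProdArrow E E ι (fun _ => φ) (fun _ => ν)).symm
  have m : MeasurePreserving (fun (f : ι ⊕ ι → E) i => (f (Sum.inl i), f (Sum.inr i)))
    (Measure.pi (Sum.elim (fun _ : ι => φ) (fun _ : ι => ν))) (Measure.pi fun _ => φ.prod ν) :=
    m2.comp m1
  exact m.fun_comp_hasLaw hall

/-! ### Standardized products and the statistic. -/

namespace ThresholdModel

variable {d : ℕ} (M : ThresholdModel d)

/-- Rules out `∞ * 0 = 0` in `momentRatio`, so that finiteness of the ratio forces `Ψ(A) > 0`. -/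
lemma thresholdMoment_ne_zero (j k : Fin d) : M.thresholdMoment j k ≠ 0 := by
  unfold thresholdMoment
  rw [Ne, lintegral_eq_zero_iff (by fun_prop)]
  intro h
  obtain ⟨t, h0, ht⟩ := (h.and M.threshold_mem).exists
  have h1 := (ht j).1
  have h2 := (ht k).1
  have h3 : 0 < 1 - t j := sub_pos.2 (ht j).2
  have h4 : 0 < 1 - t k := sub_pos.2 (ht k).2
  have : 0 < (t j)⁻¹ * (t k)⁻¹ * (1 - t j)⁻¹ * (1 - t k)⁻¹ := by positivity
  simp only [Pi.zero_apply, ENNReal.ofReal_eq_zero] at h0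
  exact absurd this (not_lt.2 h0)

variable {j : Fin d} {A : Finset (Fin d)}

lemma Psi_pos_of_momentRatio_ne_top (hA : A.Nonempty) (h : M.momentRatio j A ≠ ∞) :
    0 < M.Psi A := by
  by_contra hneg
  obtain ⟨k, hk⟩ := hA
  refine h ?_
  have hs : ∑ k ∈ A, M.thresholdMoment j k ≠ 0 := fun h0 =>
    M.thresholdMoment_ne_zero j k ((Finset.sum_eq_zero_iff.1 h0) k hk)
  rw [momentRatio, ENNReal.ofReal_of_nonpos (not_lt.1 hneg), zero_pow two_ne_zero, ENNReal.inv_zero,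
    ENNReal.top_mul]
  exact mul_ne_zero (by simp) hs

lemma mean_thresholdMoment_ne_top (h : M.momentRatio j A ≠ ∞) :
    (A.card : ℝ≥0∞)⁻¹ * ∑ k ∈ A, M.thresholdMoment j k ≠ ∞ := fun hS => by
  refine h ?_
  rw [momentRatio, hS, ENNReal.mul_top]
  simp

/-- The product `U_j U_A`, standardized by `√Ψ(A)`, as a function of `(Z, θ)`. -/
noncomputable def stdProd (j : Fin d) (A : Finset (Fin d)) (p : (Fin d → ℝ) × (Fin d → ℝ)) : ℝ :=
  M.U p.1 p.2 j * M.UAvg p.1 p.2 A / √(M.Psi A)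

lemma measurable_stdProd (j : Fin d) (A : Finset (Fin d)) : Measurable (M.stdProd j A) :=
  (M.measurable_U_mul_UAvg j A).div_const _

/-- The law of the standardized product `U_j U_A / √Ψ(A)`. -/
noncomputable def stdLaw (j : Fin d) (A : Finset (Fin d)) : Measure ℝ :=
  (M.φ.prod M.ν).map (M.stdProd j A)

instance (j : Fin d) (A : Finset (Fin d)) : IsProbabilityMeasure (M.stdLaw j A) :=
  Measure.isProbabilityMeasure_map (M.measurable_stdProd j A).aemeasurable

lemma integral_stdLaw_pow (j : Fin d) (A : Finset (Fin d)) (r : ℕ) :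
    ∫ x, x ^ r ∂(M.stdLaw j A)
      = (∫ p : (Fin d → ℝ) × (Fin d → ℝ), (M.U p.1 p.2 j * M.UAvg p.1 p.2 A) ^ r
        ∂(M.φ.prod M.ν)) / √(M.Psi A) ^ r := by
  rw [stdLaw, integral_map (M.measurable_stdProd j A).aemeasurable (by fun_prop), ← integral_div]
  simp only [stdProd, div_pow]

lemma integral_stdLaw (hA : A.Nonempty)
    (hi : IndepFun (fun z : Fin d → ℝ => z j) (fun (z : Fin d → ℝ) (k : A) => z k) M.φ)
    (hR : M.momentRatio j A ≠ ∞) : ∫ x, x ∂(M.stdLaw j A) = 0 := by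
  have := M.integral_stdLaw_pow j A 1
  simp only [pow_one] at this
  rw [this, M.integral_U_mul_UAvg hA hi (M.mean_thresholdMoment_ne_top hR), zero_div]

lemma integral_stdLaw_sq (hA : A.Nonempty)
    (hi : IndepFun (fun z : Fin d → ℝ => z j) (fun (z : Fin d → ℝ) (k : A) => z k) M.φ)
    (hR : M.momentRatio j A ≠ ∞) : ∫ x, x ^ 2 ∂(M.stdLaw j A) = 1 := by
  have hΨ := M.Psi_pos_of_momentRatio_ne_top hA hR
  rw [M.integral_stdLaw_pow, M.integral_U_mul_UAvg_sq hA hi (M.mean_thresholdMoment_ne_top hR),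
    Real.sq_sqrt hΨ.le, div_self hΨ.ne']

lemma integrable_stdLaw_pow_four (hA : A.Nonempty)
    (hi : IndepFun (fun z : Fin d → ℝ => z j) (fun (z : Fin d → ℝ) (k : A) => z k) M.φ)
    (hR : M.momentRatio j A ≠ ∞) : Integrable (fun x : ℝ => x ^ 4) (M.stdLaw j A) := by
  rw [stdLaw, integrable_map_measure (by fun_prop) (M.measurable_stdProd j A).aemeasurable]
  refine ((M.integrable_U_mul_UAvg_pow_four hA hi (M.mean_thresholdMoment_ne_top hR)).div_const
    (√(M.Psi A) ^ 4)).congr (ae_of_all _ fun p => ?_)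
  simp only [stdProd, Function.comp, div_pow]

/-- Dividing the product by `√Ψ(A)` divides its fourth moment by `Ψ(A)²`, the first factor of
`momentRatio`. -/
lemma ofReal_integral_stdLaw_pow_four_le (hA : A.Nonempty)
    (hi : IndepFun (fun z : Fin d → ℝ => z j) (fun (z : Fin d → ℝ) (k : A) => z k) M.φ)
    (hR : M.momentRatio j A ≠ ∞) :
    ENNReal.ofReal (∫ x, x ^ 4 ∂(M.stdLaw j A)) ≤ M.momentRatio j A := by
  have hΨ := M.Psi_pos_of_momentRatio_ne_top hA hR
  have hs : √(M.Psi A) ^ 4 = M.Psi A ^ 2 := by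
    rw [show 4 = 2 * 2 from rfl, pow_mul, Real.sq_sqrt hΨ.le]
  rw [M.integral_stdLaw_pow, hs, ENNReal.ofReal_div_of_pos (by positivity),
    ENNReal.ofReal_pow hΨ.le, ofReal_integral_eq_lintegral_ofReal
      (M.integrable_U_mul_UAvg_pow_four hA hi (M.mean_thresholdMoment_ne_top hR))
      (ae_of_all _ fun p => (by decide : Even 4).pow_nonneg _), momentRatio,
    ENNReal.div_eq_inv_mul]
  gcongr
  exact M.lintegral_U_mul_UAvg_pow_four_le hA hi

lemma aemeasurable_statistic {Ω : Type*} [MeasurableSpace Ω] {P : Measure Ω} {n : ℕ}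
    {Z θ : Fin n → Ω → Fin d → ℝ} (hZ : ∀ i, AEMeasurable (Z i) P)
    (hθ : ∀ i, AEMeasurable (θ i) P) (j : Fin d) (A : Finset (Fin d)) :
    AEMeasurable (fun ω => √(n : ℝ) * (M.psiHat (fun i => Z i ω) (fun i => θ i ω) j A /
      M.sigmaHat (fun i => Z i ω) (fun i => θ i ω) j A)) P := by
  have hU : ∀ i, AEMeasurable (fun ω => M.U (Z i ω) (θ i ω) j) P := fun i =>
    (M.measurable_U j).comp_aemeasurable ((hZ i).prodMk (hθ i))
  have hV : ∀ i, AEMeasurable (fun ω => M.UAvg (Z i ω) (θ i ω) A) P := fun i => by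
    unfold UAvg
    exact (Finset.aemeasurable_fun_sum _ fun k _ =>
      (M.measurable_U k).comp_aemeasurable ((hZ i).prodMk (hθ i))).const_mul _
  have h1 : AEMeasurable (fun ω => M.psiHat (fun i => Z i ω) (fun i => θ i ω) j A) P := by
    unfold psiHat
    exact (Finset.aemeasurable_fun_sum _ fun i _ => (hU i).mul (hV i)).const_mul _
  have h2 : AEMeasurable (fun ω => M.sigmaHatSq (fun i => Z i ω) (fun i => θ i ω) j A) P := by
    unfold sigmaHatSq
    exact (Finset.aemeasurable_fun_sum _ fun i _ =>
      ((hU i).pow_const 2).mul ((hV i).pow_const 2)).const_mul _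
  exact (h1.div h2.sqrt).const_mul _

/-- The studentized sample latent correlation is invariant under standardization. -/
lemma statistic_eq (hΨ : 0 < M.Psi A) {n : ℕ} (hn : 0 < n) (z t : Fin n → Fin d → ℝ) :
    (√(n : ℝ))⁻¹ * (∑ i, M.stdProd j A (z i, t i))
        * (√(1 / (n : ℝ) * ∑ i, M.stdProd j A (z i, t i) ^ 2))⁻¹
      = √(n : ℝ) * (M.psiHat z t j A / M.sigmaHat z t j A) := by
  have hn' : (0 : ℝ) < n := by exact_mod_cast hn
  have hc : 0 < √(M.Psi A) := Real.sqrt_pos.2 hΨ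
  have hs : 0 < √(n : ℝ) := Real.sqrt_pos.2 hn'
  unfold sigmaHat psiHat sigmaHatSq stdProd
  simp only [div_pow, ← Finset.sum_div, mul_pow]
  rw [← mul_div_assoc (1 / (n : ℝ)), Real.sqrt_div' _ (sq_nonneg _), Real.sqrt_sq hc.le, inv_div]
  have e : √(n : ℝ) * (1 / (n : ℝ)) = (√(n : ℝ))⁻¹ := by
    rw [mul_one_div, Real.sqrt_div_self]
  rw [← e]
  field_simp

end ThresholdModel

theorem theorem1
    -- for each `n`, a threshold model `(φ_n, ν_n)` in dimension `d_n`
    (d : ℕ → ℕ) (M : ∀ n, ThresholdModel (d n))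
    -- independent `Z_1, …, Z_n ∼ φ_n` and `θ_1, …, θ_n ∼ ν_n`
    {Ω : ℕ → Type*} [∀ n, MeasurableSpace (Ω n)]
    (P : ∀ n, Measure (Ω n)) [∀ n, IsProbabilityMeasure (P n)]
    (Z θ : ∀ n, Fin n → Ω n → Fin (d n) → ℝ)
    (hZ : ∀ n i, HasLaw (Z n i) (M n).φ (P n))
    (hθ : ∀ n i, HasLaw (θ n i) (M n).ν (P n))
    (hindep : ∀ n, iIndepFun (Sum.elim (Z n) (θ n)) (P n))
    -- a fixed variable `j` and nonempty sets `A_n ⊆ [d_n] \ {j}`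
    (j : ℕ) (hj : ∀ n, j < d n)
    (A : ∀ n, Finset (Fin (d n))) (hA : ∀ n, (A n).Nonempty)
    (hjA : ∀ n, (⟨j, hj n⟩ : Fin (d n)) ∉ A n)
    -- (i) `Z_j` is independent of `{Z_k : k ∈ A_n}` under `φ_n`
    (hi : ∀ n, IndepFun (fun z : Fin (d n) → ℝ => z ⟨j, hj n⟩)
      (fun (z : Fin (d n) → ℝ) (k : A n) => z k) (M n).φ)
    -- (ii) the normalized moment quantity is `o(n)`
    (hii : Tendsto (fun n : ℕ => (M n).momentRatio ⟨j, hj n⟩ (A n) / (n : ℝ≥0∞)) atTop (𝓝 0)) :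
    TendstoInDistribution
      (fun (n : ℕ) (ω : Ω n) =>
        √(n : ℝ) *
          ((M n).psiHat (fun i => Z n i ω) (fun i => θ n i ω) ⟨j, hj n⟩ (A n) /
            (M n).sigmaHat (fun i => Z n i ω) (fun i => θ n i ω) ⟨j, hj n⟩ (A n)))
      atTop (id : ℝ → ℝ) P (gaussianReal 0 1) := by 
  -- Since `∞ / n = ∞`, (ii) forces finite ratios for large `n` only; hence the moment hypotheses of
  -- the limit theorems are stated eventually.
  have hfin : ∀ᶠ n in atTop, (M n).momentRatio ⟨j, hj n⟩ (A n) ≠ ∞ := by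
    filter_upwards [hii.eventually_lt_const ENNReal.zero_lt_top] with n h hR
    rw [hR, ENNReal.top_div_of_ne_top (ENNReal.natCast_ne_top n)] at h
    exact lt_irrefl _ h
  have hpair := fun n => iIndepFun_pair_of_sumElim (hZ n) (hθ n) (hindep n)
  have hlim : Tendsto (fun n : ℕ =>
      (∫ x, x ^ 4 ∂((M n).stdLaw ⟨j, hj n⟩ (A n))) / n) atTop (𝓝 0) := by
    have h0 : ∀ n, 0 ≤ ∫ x, x ^ 4 ∂((M n).stdLaw ⟨j, hj n⟩ (A n)) := fun n =>
      integral_nonneg fun x => (by decide : Even 4).pow_nonneg _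
    have : Tendsto (fun n : ℕ => ENNReal.ofReal
        ((∫ x, x ^ 4 ∂((M n).stdLaw ⟨j, hj n⟩ (A n))) / n)) atTop (𝓝 0) := by
      refine tendsto_of_tendsto_of_tendsto_of_le_of_le' tendsto_const_nhds hii
        (Eventually.of_forall fun n => zero_le) ?_
      filter_upwards [hfin, eventually_gt_atTop 0] with n hR hn
      rw [ENNReal.ofReal_div_of_pos (by exact_mod_cast hn), ENNReal.ofReal_natCast]
      gcongr
      exact (M n).ofReal_integral_stdLaw_pow_four_le (hA n) (hi n) hR
    have := (ENNReal.tendsto_toReal ENNReal.zero_ne_top).comp this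
    refine this.congr fun n => ?_
    exact ENNReal.toReal_ofReal (div_nonneg (h0 n) (Nat.cast_nonneg n))
  have key := tendstoInDistribution_self_normalized
    (μ := fun n => (M n).stdLaw ⟨j, hj n⟩ (A n)) (P := P)
    (Y := fun n i ω => (M n).stdProd ⟨j, hj n⟩ (A n) (Z n i ω, θ n i ω))
    (fun n i => HasLaw.fun_comp ⟨((M n).measurable_stdProd _ _).aemeasurable, rfl⟩ ((hpair n).1 i))
    (fun n => (hpair n).2.comp (fun _ => (M n).stdProd ⟨j, hj n⟩ (A n))
      fun _ => (M n).measurable_stdProd _ _)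
    (by filter_upwards [hfin] with n hR using
      (M n).integrable_stdLaw_pow_four (hA n) (hi n) hR)
    (by filter_upwards [hfin] with n hR using (M n).integral_stdLaw (hA n) (hi n) hR)
    (by filter_upwards [hfin] with n hR using (M n).integral_stdLaw_sq (hA n) (hi n) hR)
    hlim
  refine ⟨fun n => (M n).aemeasurable_statistic (fun i => (hZ n i).aemeasurable)
    (fun i => (hθ n i).aemeasurable) _ _, aemeasurable_id, key.tendsto.congr' ?_⟩
  filter_upwards [hfin, eventually_gt_atTop 0] with n hR hn
  refine Subtype.ext ?_
  simp only
  congr 1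
  funext ω
  exact (M n).statistic_eq ((M n).Psi_pos_of_momentRatio_ne_top (hA n) hR) hn _ _
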